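/- An adequate monoid is a monoid $M$ with two unary operations $x\mapsto x^+$ and $x\mapsto x^*$ satisfying, for all $x,y,z\in M$, $$x^+x=x,\quad (x^+y^+)^+=x^+y^+=y^+x^+,\quad (xy)^+=(xy^+)^+,\quad x^2=x\Rightarrow x=x^+,\quad xz=yz\Rightarrow xz^+=yz^+,$$ $$xx^*=x,\quad (x^*y^*)^*=x^*y^*=y^*x^*,\quad (xy)^*=(x^*y)^*,\quad x^2=x\Rightarrow x=x^*,\quad zx=zy\Rightarrow z^*x=z^*y.$$ For a set $X$, let $\mathrm{FAd}(X)$ be the free adequate monoid on $X$, in the signature $(\cdot,{}^+,{}^*,1)$. For $n\ge 0$ let $B(n)$ be the set of elements of $\mathrm{FAd}(X)$ that are represented by a word over $X$ in this signature with at most $n$ occurrences of letters of $X$, and let $S(n)=B(n)\setminus B(n-1)$, where $B(-1)=\emptyset$. If $X$ is nonempty, then $\mathrm{FAd}(X)$ has exponential growth, that is: there is a real $c>1$ such that $|S(n)|\ge c^n$ for all sufficiently large $n$, and likewise for $|B(n)|$ (these cardinalities may be infinite if $X$ is infinite); and if $X$ is moreover finite, then there is a real $C$ such that $|S(n)|\le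 C^n$ for all sufficiently large $n$, and likewise for $|B(n)|$. -/

import Mathlib

open scoped NNReal ENNReal

namespace AdequateGrowth

universe u v

/-- A monoid with two further unary operations (signature `(2,1,1,0)`):
`plus x` is `x⁺` and `ast x` is `x*`. No law is imposed on the unary operations. -/
class BiunaryMonoid (M : Type u) extends Monoid M where
  plus : M → M
  ast : M → M

open BiunaryMonoid

/-- `M` is left adequate with respect to `⁺`. -/
structure IsLeftAdequate (M : Type u) [BiunaryMonoid M] : Prop where
  plus_mul_self : ∀ x : M, plus x * x = x
  plus_plus_mul_plus : ∀ x y : M, plus (plus x * plus y) = plus x * plus y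
  plus_mul_comm : ∀ x y : M, plus x * plus y = plus y * plus x
  plus_mul : ∀ x y : M, plus (x * y) = plus (x * plus y)
  eq_plus_of_idem : ∀ x : M, x * x = x → x = plus x
  mul_plus_cancel : ∀ x y z : M, x * z = y * z → x * plus z = y * plus z

/-- `M` is right adequate with respect to `*`. -/
structure IsRightAdequate (M : Type u) [BiunaryMonoid M] : Prop where
  mul_ast_self : ∀ x : M, x * ast x = x
  ast_ast_mul_ast : ∀ x y : M, ast (ast x * ast y) = ast x * ast y
  ast_mul_comm : ∀ x y : M, ast x * ast y = ast y * ast x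
  ast_mul : ∀ x y : M, ast (x * y) = ast (ast x * y)
  eq_ast_of_idem : ∀ x : M, x * x = x → x = ast x
  ast_mul_cancel : ∀ x y z : M, z * x = z * y → ast z * x = ast z * y

/-- (Two-sided) adequate monoids. -/
structure IsAdequate (M : Type u) [BiunaryMonoid M] : Prop where
  left : IsLeftAdequate M
  right : IsRightAdequate M

/-- `f` is a morphism of algebras of signature `(2,1,1,0)`. -/
structure IsBiunaryHom {M : Type u} {N : Type v} [BiunaryMonoid M] [BiunaryMonoid N]
    (f : M → N) : Prop where
  map_one : f 1 = 1
  map_mul : ∀ x y : M, f (x * y) = f x * f y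
  map_plus : ∀ x : M, f (plus x) = plus (f x)
  map_ast : ∀ x : M, f (ast x) = ast (f x)

/-- Words over `X` in the signature `(2,1,1,0)`. -/
inductive Word (X : Type u) : Type u
  | letter : X → Word X
  | one : Word X
  | mul : Word X → Word X → Word X
  | plus : Word X → Word X
  | ast : Word X → Word X

namespace Word

/-- The number of occurrences of letters of `X` in a word. -/
def length {X : Type u} : Word X → ℕ
  | letter _ => 1
  | one => 0
  | mul s t => length s + length t
  | plus t => length t
  | ast t => length t

/-- The value of a word in a biunary monoid under an assignment of the letters. -/
def eval {X : Type u} {M : Type v} [BiunaryMonoid M] (f : X → M) : Word X → M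
  | letter x => f x
  | one => 1
  | mul s t => eval f s * eval f t
  | plus t => BiunaryMonoid.plus (eval f t)
  | ast t => BiunaryMonoid.ast (eval f t)

/-- The least congruence on words that contains the monoid laws and is closed under the
quasi-identities of adequate monoids. -/
inductive Rel {X : Type u} : Word X → Word X → Prop
  | refl (s : Word X) : Rel s s
  | symm {s t : Word X} : Rel s t → Rel t s
  | trans {s t r : Word X} : Rel s t → Rel t r → Rel s r
  | mul_congr {s s' t t' : Word X} : Rel s s' → Rel t t' → Rel (mul s t) (mul s' t')
  | plus_congr {s s' : Word X} : Rel s s' → Rel (plus s) (plus s')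
  | ast_congr {s s' : Word X} : Rel s s' → Rel (ast s) (ast s')
  | mul_assoc (x y z : Word X) : Rel (mul (mul x y) z) (mul x (mul y z))
  | one_mul (x : Word X) : Rel (mul one x) x
  | mul_one (x : Word X) : Rel (mul x one) x
  | plus_mul_self (x : Word X) : Rel (mul (plus x) x) x
  | plus_plus_mul_plus (x y : Word X) :
      Rel (plus (mul (plus x) (plus y))) (mul (plus x) (plus y))
  | plus_mul_comm (x y : Word X) : Rel (mul (plus x) (plus y)) (mul (plus y) (plus x))
  | plus_mul (x y : Word X) : Rel (plus (mul x y)) (plus (mul x (plus y)))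
  | eq_plus_of_idem (x : Word X) : Rel (mul x x) x → Rel x (plus x)
  | mul_plus_cancel (x y z : Word X) :
      Rel (mul x z) (mul y z) → Rel (mul x (plus z)) (mul y (plus z))
  | mul_ast_self (x : Word X) : Rel (mul x (ast x)) x
  | ast_ast_mul_ast (x y : Word X) :
      Rel (ast (mul (ast x) (ast y))) (mul (ast x) (ast y))
  | ast_mul_comm (x y : Word X) : Rel (mul (ast x) (ast y)) (mul (ast y) (ast x))
  | ast_mul (x y : Word X) : Rel (ast (mul x y)) (ast (mul (ast x) y))
  | eq_ast_of_idem (x : Word X) : Rel (mul x x) x → Rel x (ast x)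
  | ast_mul_cancel (x y z : Word X) :
      Rel (mul z x) (mul z y) → Rel (mul (ast z) x) (mul (ast z) y)

/-- `Rel` as a setoid. -/
def relSetoid (X : Type u) : Setoid (Word X) where
  r := Rel
  iseqv := ⟨Rel.refl, Rel.symm, Rel.trans⟩

end Word

/-- The free adequate monoid `FAd(X)`, as words modulo the least adequate congruence.
Its universal property is `FAd.existsUnique_hom` below. -/
def FAd (X : Type u) : Type u := Quotient (Word.relSetoid X)

namespace FAd

/-- The canonical surjection from words over `X` to `FAd(X)`. -/
def mk {X : Type u} (w : Word X) : FAd X := Quotient.mk (Word.relSetoid X) w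

/-- The free generators. -/
def of {X : Type u} (x : X) : FAd X := mk (Word.letter x)

theorem sound {X : Type u} {s t : Word X} (h : Word.Rel s t) : mk s = mk t :=
  Quotient.sound (s := Word.relSetoid X) h

theorem exact {X : Type u} {s t : Word X} (h : mk s = mk t) : Word.Rel s t :=
  Quotient.exact (s := Word.relSetoid X) h

theorem ind {X : Type u} {p : FAd X → Prop} (h : ∀ w : Word X, p (mk w)) (a : FAd X) : p a :=
  Quotient.ind (s := Word.relSetoid X) h a

instance instBiunaryMonoid (X : Type u) : BiunaryMonoid (FAd X) where
  one := mk Word.one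
  mul := Quotient.map₂ Word.mul (fun _ _ h _ _ h' => Word.Rel.mul_congr h h')
  plus := Quotient.map Word.plus (fun _ _ h => Word.Rel.plus_congr h)
  ast := Quotient.map Word.ast (fun _ _ h => Word.Rel.ast_congr h)
  mul_assoc := fun a b c => by
    induction a using ind with | _ a
    induction b using ind with | _ b
    induction c using ind with | _ c
    exact sound (Word.Rel.mul_assoc a b c)
  one_mul := fun a => by
    induction a using ind with | _ a
    exact sound (Word.Rel.one_mul a)
  mul_one := fun a => by
    induction a using ind with | _ a
    exact sound (Word.Rel.mul_one a)

theorem isAdequate (X : Type u) : IsAdequate (FAd X) where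
  left :=
    { plus_mul_self := ind fun x => sound (.plus_mul_self x)
      plus_plus_mul_plus := ind fun x => ind fun y => sound (.plus_plus_mul_plus x y)
      plus_mul_comm := ind fun x => ind fun y => sound (.plus_mul_comm x y)
      plus_mul := ind fun x => ind fun y => sound (.plus_mul x y)
      eq_plus_of_idem := ind fun x => fun h => sound (.eq_plus_of_idem x (exact h))
      mul_plus_cancel := ind fun x => ind fun y => ind fun z => fun h =>
        sound (.mul_plus_cancel x y z (exact h)) }
  right :=
    { mul_ast_self := ind fun x => sound (.mul_ast_self x)
      ast_ast_mul_ast := ind fun x => ind fun y => sound (.ast_ast_mul_ast x y)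
      ast_mul_comm := ind fun x => ind fun y => sound (.ast_mul_comm x y)
      ast_mul := ind fun x => ind fun y => sound (.ast_mul x y)
      eq_ast_of_idem := ind fun x => fun h => sound (.eq_ast_of_idem x (exact h))
      ast_mul_cancel := ind fun x => ind fun y => ind fun z => fun h =>
        sound (.ast_mul_cancel x y z (exact h)) }

theorem eval_eq_of_rel {X : Type u} {M : Type v} [BiunaryMonoid M] (hM : IsAdequate M)
    (f : X → M) {s t : Word X} (h : Word.Rel s t) : s.eval f = t.eval f := by
  induction h with
  | refl => rfl
  | symm _ ih => exact ih.symm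
  | trans _ _ ih ih' => exact ih.trans ih'
  | mul_congr _ _ ih ih' => exact congrArg₂ (· * ·) ih ih'
  | plus_congr _ ih => exact congrArg BiunaryMonoid.plus ih
  | ast_congr _ ih => exact congrArg BiunaryMonoid.ast ih
  | mul_assoc => exact _root_.mul_assoc _ _ _
  | one_mul => exact _root_.one_mul _
  | mul_one => exact _root_.mul_one _
  | plus_mul_self => exact hM.left.plus_mul_self _
  | plus_plus_mul_plus => exact hM.left.plus_plus_mul_plus _ _
  | plus_mul_comm => exact hM.left.plus_mul_comm _ _
  | plus_mul => exact hM.left.plus_mul _ _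
  | eq_plus_of_idem _ _ ih => exact hM.left.eq_plus_of_idem _ ih
  | mul_plus_cancel _ _ _ _ ih => exact hM.left.mul_plus_cancel _ _ _ ih
  | mul_ast_self => exact hM.right.mul_ast_self _
  | ast_ast_mul_ast => exact hM.right.ast_ast_mul_ast _ _
  | ast_mul_comm => exact hM.right.ast_mul_comm _ _
  | ast_mul => exact hM.right.ast_mul _ _
  | eq_ast_of_idem _ _ ih => exact hM.right.eq_ast_of_idem _ ih
  | ast_mul_cancel _ _ _ _ ih => exact hM.right.ast_mul_cancel _ _ _ ih

/-- `FAd X` is freely generated by `X` in the class of adequate monoids. -/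
theorem existsUnique_hom {X : Type u} {M : Type v} [BiunaryMonoid M] (hM : IsAdequate M)
    (f : X → M) : ∃! φ : FAd X → M, IsBiunaryHom φ ∧ ∀ x : X, φ (of x) = f x := by
  refine ⟨Quotient.lift (s := Word.relSetoid X) (fun w => w.eval f)
    (fun _ _ h => eval_eq_of_rel hM f h), ⟨⟨rfl, ?_, ?_, ?_⟩, fun x => rfl⟩, ?_⟩
  · exact ind fun x => ind fun y => rfl
  · exact ind fun x => rfl
  · exact ind fun x => rfl
  · rintro φ ⟨hφ, hof⟩
    funext a
    induction a using ind with | _ w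
    induction w with
    | letter x => exact hof x
    | one => exact hφ.map_one
    | mul s t ihs iht =>
      exact (hφ.map_mul (mk s) (mk t)).trans (congrArg₂ (· * ·) ihs iht)
    | plus s ih => exact (hφ.map_plus (mk s)).trans (congrArg BiunaryMonoid.plus ih)
    | ast s ih => exact (hφ.map_ast (mk s)).trans (congrArg BiunaryMonoid.ast ih)

/-- The ball `B(n)`: the elements represented by a word with at most `n` letters. -/
def ball (X : Type u) (n : ℕ) : Set (FAd X) :=
  {a | ∃ w : Word X, w.length ≤ n ∧ w.eval of = a}

/-- The sphere `S(n) = B(n) \ B(n - 1)`, where `B(-1)` is empty. -/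
def sphere (X : Type u) (n : ℕ) : Set (FAd X) :=
  {a | a ∈ ball X n ∧ ∀ m < n, a ∉ ball X m}

end FAd

/-- `f` grows at least exponentially: `f n ≥ c ^ n` for some `c > 1` and all large `n`. -/
def GrowsAtLeastExponentially (f : ℕ → ℕ∞) : Prop :=
  ∃ c : ℝ≥0, 1 < c ∧ ∀ᶠ n in Filter.atTop, (c : ℝ≥0∞) ^ n ≤ (f n : ℝ≥0∞)

/-- `f` grows at most exponentially: `f n ≤ C ^ n` for some finite `C` and all large `n`. -/
def GrowsAtMostExponentially (f : ℕ → ℕ∞) : Prop :=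
  ∃ C : ℝ≥0, ∀ᶠ n in Filter.atTop, (f n : ℝ≥0∞) ≤ (C : ℝ≥0∞) ^ n

end AdequateGrowth

namespace AdequateGrowth

open BiunaryMonoid Filter

universe u v

/-! ### Idempotents and the unary operations -/

section Adequate

variable {M : Type u} [BiunaryMonoid M]

/-! Upper bound: both unary operations fix idempotents, so a chain of them collapses to its
innermost member. An element of B(n) is therefore 1 or the value of an expression with at most n
letters, fewer than n products and at most one unary operation per subexpression. In postfix form
this is a program of at most 4n instructions, and there are at most |X| + 4 instructions
(`FAd.encard_ball_le`).

Lower bound: an orientation `l` of a path gives a word `pathWord x l` with one letter per edge. It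
is tested in an adequate monoid of relations on the vertices of an oriented path, every letter
acting as the edge relation. There it holds at `a` exactly when the path `l` can be mapped into the
graph starting at `a`, possibly with folds. Edges change height by one, so if the target has the
same length and reaches the end height of `l` only at its end, no fold is possible and the
orientations agree. Hence such words are pairwise distinct (`mk_pathWord_injective`). A word with
fewer letters would survive the deletion of some edge, so it cannot represent the same element
(`mk_pathWord_mem_sphere`). Zigzags followed by a climb give 2^m such paths of length 2m + k. -/

theorem IsAdequate.plus_mul_plus_self (hM : IsAdequate M) (x : M) :
    plus x * plus x = plus x := by
  -- The quasi-identity turns x⁺x = 1x into x⁺x⁺ = 1x⁺.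
  have h := hM.left.mul_plus_cancel (plus x) 1 x (by rw [hM.left.plus_mul_self, one_mul])
  rwa [one_mul] at h

theorem IsAdequate.ast_mul_ast_self (hM : IsAdequate M) (x : M) : ast x * ast x = ast x := by
  have h := hM.right.ast_mul_cancel (ast x) 1 x (by rw [hM.right.mul_ast_self, mul_one])
  rwa [mul_one] at h

theorem IsAdequate.plus_plus (hM : IsAdequate M) (x : M) : plus (plus x) = plus x :=
  (hM.left.eq_plus_of_idem _ (hM.plus_mul_plus_self x)).symm

theorem IsAdequate.ast_plus (hM : IsAdequate M) (x : M) : ast (plus x) = plus x :=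
  (hM.right.eq_ast_of_idem _ (hM.plus_mul_plus_self x)).symm

theorem IsAdequate.plus_ast (hM : IsAdequate M) (x : M) : plus (ast x) = ast x :=
  (hM.left.eq_plus_of_idem _ (hM.ast_mul_ast_self x)).symm

theorem IsAdequate.ast_ast (hM : IsAdequate M) (x : M) : ast (ast x) = ast x :=
  (hM.right.eq_ast_of_idem _ (hM.ast_mul_ast_self x)).symm

theorem IsAdequate.plus_one (hM : IsAdequate M) : plus (1 : M) = 1 :=
  (hM.left.eq_plus_of_idem _ (one_mul 1)).symm

theorem IsAdequate.ast_one (hM : IsAdequate M) : ast (1 : M) = 1 :=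
  (hM.right.eq_ast_of_idem _ (one_mul 1)).symm

end Adequate

/-! ### The upper bound: elements as outputs of a stack machine -/

/-- Instructions of a stack machine that computes values of words. -/
inductive Instr (X : Type u) : Type u
  | push : X → Instr X
  | mul : Instr X
  | plus : Instr X
  | ast : Instr X
  | nop : Instr X

namespace Instr

/-- Instructions are letters or one of four further symbols. -/
def toSum {X : Type u} : Instr X → X ⊕ Fin 4
  | push x => .inl x
  | mul => .inr 0
  | plus => .inr 1
  | ast => .inr 2
  | nop => .inr 3

theorem toSum_injective {X : Type u} : Function.Injective (toSum (X := X)) := by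
  intro a b h
  cases a <;> cases b <;> simp_all [toSum]

instance {X : Type u} [Finite X] : Finite (Instr X) := Finite.of_injective _ toSum_injective

theorem card_le (X : Type u) [Finite X] : Nat.card (Instr X) ≤ Nat.card X + 4 := by
  have h := Nat.card_le_card_of_injective _ (toSum_injective (X := X))
  rwa [Nat.card_sum, Nat.card_fin] at h

variable {X : Type u} {M : Type v} [BiunaryMonoid M] (f : X → M)

/-- The effect of one instruction on the stack. -/
def step : List M → Instr X → List M
  | s, push x => f x :: s
  | b :: a :: s, mul => a * b :: s
  | a :: s, plus => BiunaryMonoid.plus a :: s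
  | a :: s, ast => BiunaryMonoid.ast a :: s
  | s, _ => s

/-- The program `L` pushes `a`. -/
def Computes (L : List (Instr X)) (a : M) : Prop :=
  ∀ s : List M, L.foldl (step f) s = a :: s

variable {f}

theorem Computes.mul {L L' : List (Instr X)} {a b : M} (h : Computes f L a)
    (h' : Computes f L' b) : Computes f (L ++ L' ++ [Instr.mul]) (a * b) := by
  intro s
  simp only [List.foldl_append, h s, h' (a :: s)]
  rfl

theorem Computes.plus {L : List (Instr X)} {a : M} (h : Computes f L a) :
    Computes f (L ++ [Instr.plus]) (BiunaryMonoid.plus a) := by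
  intro s
  simp only [List.foldl_append, h s]
  rfl

theorem Computes.ast {L : List (Instr X)} {a : M} (h : Computes f L a) :
    Computes f (L ++ [Instr.ast]) (BiunaryMonoid.ast a) := by
  intro s
  simp only [List.foldl_append, h s]
  rfl

theorem step_nop (s : List M) : step f s nop = s := by
  rcases s with _ | ⟨a, _ | ⟨b, s⟩⟩ <;> rfl

theorem foldl_replicate_nop (k : ℕ) (s : List M) :
    (List.replicate k (nop : Instr X)).foldl (step f) s = s := by
  induction k with
  | zero => rfl
  | succ k ih => rw [List.replicate_succ, List.foldl_cons, step_nop, ih]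

variable (f) in
/-- `a` is the value of a program with at most `k` instructions, or of its `⁺` or `*`. -/
def ComputableIn (k : ℕ) (a : M) : Prop :=
  ∃ (L : List (Instr X)) (b : M), L.length ≤ k ∧ Computes f L b ∧
    (a = b ∨ a = BiunaryMonoid.plus b ∨ a = BiunaryMonoid.ast b)

theorem ComputableIn.exists_computes {k : ℕ} {a : M} (h : ComputableIn f k a) :
    ∃ L : List (Instr X), L.length ≤ k + 1 ∧ Computes f L a := by
  obtain ⟨L, b, hL, hb, rfl | rfl | rfl⟩ := h
  · exact ⟨L, by lia, hb⟩
  · exact ⟨_, by simpa using hL, hb.plus⟩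
  · exact ⟨_, by simpa using hL, hb.ast⟩

/-- The last unary operation is kept outside the program, so that a further one is absorbed at no
cost. A product performs both pending operations and multiplies: (4s - 3 + 1) + (4t - 3 + 1) + 1 =
4(s + t) - 3. The value 1 is set apart because a word may contain any number of factors `one`. -/
theorem eval_eq_one_or_computableIn (hM : IsAdequate M) (w : Word X) :
    w.eval f = 1 ∨ 1 ≤ w.length ∧ ComputableIn f (4 * w.length - 3) (w.eval f) := by
  induction w with
  | letter x => exact .inr ⟨le_rfl, [push x], f x, le_rfl, fun _ => rfl, .inl rfl⟩
  | one => exact .inl rfl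
  | mul s t ihs iht =>
    simp only [Word.eval, Word.length]
    rcases ihs with hs | ⟨hs, hs'⟩
    · rw [hs, one_mul]
      rcases iht with ht | ⟨ht, L, b, hL, h⟩
      · exact .inl ht
      · exact .inr ⟨by lia, L, b, by lia, h⟩
    · rcases iht with ht | ⟨ht, ht'⟩
      · rw [ht, mul_one]
        obtain ⟨L, b, hL, h⟩ := hs'
        exact .inr ⟨by lia, L, b, by lia, h⟩
      · obtain ⟨L, hL, h⟩ := hs'.exists_computes
        obtain ⟨L', hL', h'⟩ := ht'.exists_computes
        refine .inr ⟨by lia, _, _, ?_, h.mul h', .inl rfl⟩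
        simp only [List.length_append, List.length_singleton]
        lia
  | plus s ih =>
    simp only [Word.eval, Word.length]
    rcases ih with h | ⟨hs, L, b, hL, hb, h | h | h⟩
    · rw [h, hM.plus_one]; exact .inl rfl
    · rw [h]; exact .inr ⟨hs, L, b, hL, hb, .inr (.inl rfl)⟩
    · rw [h, hM.plus_plus]; exact .inr ⟨hs, L, b, hL, hb, .inr (.inl rfl)⟩
    · rw [h, hM.plus_ast]; exact .inr ⟨hs, L, b, hL, hb, .inr (.inr rfl)⟩
  | ast s ih =>
    simp only [Word.eval, Word.length]
    rcases ih with h | ⟨hs, L, b, hL, hb, h | h | h⟩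
    · rw [h, hM.ast_one]; exact .inl rfl
    · rw [h]; exact .inr ⟨hs, L, b, hL, hb, .inr (.inr rfl)⟩
    · rw [h, hM.ast_plus]; exact .inr ⟨hs, L, b, hL, hb, .inr (.inl rfl)⟩
    · rw [h, hM.ast_ast]; exact .inr ⟨hs, L, b, hL, hb, .inr (.inr rfl)⟩

theorem exists_program (hM : IsAdequate M) {w : Word X} {n : ℕ} (hw : w.length ≤ n) :
    ∃ L : List (Instr X), L.length = 4 * n ∧ (L.foldl (step f) []).headD 1 = w.eval f := by
  rcases eval_eq_one_or_computableIn (f := f) hM w with h | ⟨h1, h⟩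
  -- The empty stack reads as the default 1.
  · exact ⟨List.replicate (4 * n) nop, by simp, by rw [foldl_replicate_nop, h]; rfl⟩
  · obtain ⟨L, hL, h⟩ := h.exists_computes
    refine ⟨L ++ List.replicate (4 * n - L.length) nop, ?_, ?_⟩
    · simp only [List.length_append, List.length_replicate]
      lia
    · rw [List.foldl_append, foldl_replicate_nop, h]
      rfl

end Instr

/-! ### Counting programs -/

theorem FAd.encard_ball_le (X : Type u) [Finite X] (n : ℕ) :
    (FAd.ball X n).encard ≤ (((Nat.card X + 4) ^ (4 * n) : ℕ) : ℕ∞) := by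
  have hsub : FAd.ball X n ⊆ Set.range (fun p : Fin (4 * n) → Instr X =>
      ((List.ofFn p).foldl (Instr.step FAd.of) []).headD 1) := by
    rintro a ⟨w, hw, rfl⟩
    obtain ⟨L, hL, h⟩ := Instr.exists_program (f := FAd.of) (FAd.isAdequate X) hw
    refine ⟨fun i => L.get (i.cast hL.symm), ?_⟩
    have hp : List.ofFn (fun i : Fin (4 * n) => L.get (i.cast hL.symm)) = L := by
      rw [← List.ofFn_congr hL (fun i => L.get i), List.ofFn_get]
    simpa only [hp] using h
  refine (Set.encard_le_encard hsub).trans ?_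
  rw [← Set.image_univ]
  refine (Set.encard_image_le _ _).trans ?_
  rw [Set.encard_univ, ENat.card_eq_coe_natCard, Nat.card_fun, Nat.card_fin]
  exact_mod_cast Nat.pow_le_pow_left (Instr.card_le X) _

theorem FAd.sphere_subset_ball (X : Type u) (n : ℕ) : FAd.sphere X n ⊆ FAd.ball X n :=
  fun _ h => h.1

theorem FAd.ball_growsAtMostExponentially (X : Type u) [Finite X] :
    GrowsAtMostExponentially (fun n => (FAd.ball X n).encard) := by
  refine ⟨(((Nat.card X + 4) ^ 4 : ℕ) : ℝ≥0), .of_forall fun n => ?_⟩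
  have h : ((FAd.ball X n).encard : ℝ≥0∞) ≤
      (((((Nat.card X + 4) ^ (4 * n) : ℕ) : ℕ∞)) : ℝ≥0∞) :=
    ENat.toENNReal_le.2 (FAd.encard_ball_le X n)
  refine h.trans (le_of_eq ?_)
  rw [pow_mul]
  push_cast
  rfl

theorem GrowsAtMostExponentially.mono {f g : ℕ → ℕ∞} (hg : GrowsAtMostExponentially g)
    (h : ∀ n, f n ≤ g n) : GrowsAtMostExponentially f := by
  obtain ⟨C, hC⟩ := hg
  exact ⟨C, hC.mono fun n hn => (ENat.toENNReal_le.2 (h n)).trans hn⟩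

theorem GrowsAtLeastExponentially.mono {f g : ℕ → ℕ∞} (hf : GrowsAtLeastExponentially f)
    (h : ∀ n, f n ≤ g n) : GrowsAtLeastExponentially g := by
  obtain ⟨c, hc, hC⟩ := hf
  exact ⟨c, hc, hC.mono fun n hn => hn.trans (ENat.toENNReal_le.2 (h n))⟩

/-! ### Adequate monoids of binary relations -/

/-- A graded family of relations, thought of as "there is a directed walk of length `n`", in which
the length of a walk and its intermediate points are determined by its ends. -/
structure UniqueWalks (V : Type u) where
  walk : ℕ → V → V → Prop
  walk_zero : ∀ {a b : V}, walk 0 a b ↔ a = b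
  comp : ∀ {p q : ℕ} {a b c : V}, walk p a b → walk q b c → walk (p + q) a c
  length_unique : ∀ {p q : ℕ} {a b : V}, walk p a b → walk q a b → p = q
  point_unique : ∀ {p q : ℕ} {a b b' c : V},
    walk p a b → walk q b c → walk p a b' → walk q b' c → b = b'

namespace UniqueWalks

variable {V : Type u} (G : UniqueWalks V)

/-- The relations whose pairs are all joined by walks of one length. -/
def Homogeneous : Type u := {R : V → V → Prop // ∃ n, ∀ a b, R a b → G.walk n a b}

variable {G}

theorem Homogeneous.ext {R S : G.Homogeneous} (h : ∀ a b, R.1 a b ↔ S.1 a b) : R = S :=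
  Subtype.ext (funext fun a => funext fun b => propext (h a b))

theorem Homogeneous.iff_of_eq {R S : G.Homogeneous} (h : R = S) (a b : V) :
    R.1 a b ↔ S.1 a b := by rw [h]

instance : BiunaryMonoid G.Homogeneous where
  one := ⟨Eq, 0, fun _ _ h => G.walk_zero.2 h⟩
  mul R S := ⟨fun a c => ∃ b, R.1 a b ∧ S.1 b c, by
    obtain ⟨R, p, hp⟩ := R
    obtain ⟨S, q, hq⟩ := S
    exact ⟨p + q, fun a c ⟨b, h, h'⟩ => G.comp (hp a b h) (hq b c h')⟩⟩
  plus R := ⟨fun a b => a = b ∧ ∃ c, R.1 a c, 0, fun _ _ h => G.walk_zero.2 h.1⟩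
  ast R := ⟨fun a b => a = b ∧ ∃ c, R.1 c a, 0, fun _ _ h => G.walk_zero.2 h.1⟩
  mul_assoc R S T := Homogeneous.ext fun a d => by
    constructor
    · rintro ⟨c, ⟨b, h, h'⟩, h''⟩
      exact ⟨b, h, c, h', h''⟩
    · rintro ⟨b, h, c, h', h''⟩
      exact ⟨c, ⟨b, h, h'⟩, h''⟩
  one_mul R := Homogeneous.ext fun a b => ⟨by rintro ⟨_, rfl, h⟩; exact h, fun h => ⟨a, rfl, h⟩⟩
  mul_one R := Homogeneous.ext fun a b => ⟨by rintro ⟨_, h, rfl⟩; exact h, fun h => ⟨b, h, rfl⟩⟩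

theorem one_iff {a b : V} : (1 : G.Homogeneous).1 a b ↔ a = b := Iff.rfl

theorem mul_iff {R S : G.Homogeneous} {a c : V} :
    (R * S).1 a c ↔ ∃ b, R.1 a b ∧ S.1 b c := Iff.rfl

theorem plus_iff {R : G.Homogeneous} {a b : V} :
    (plus R).1 a b ↔ a = b ∧ ∃ c, R.1 a c := Iff.rfl

theorem ast_iff {R : G.Homogeneous} {a b : V} :
    (ast R).1 a b ↔ a = b ∧ ∃ c, R.1 c a := Iff.rfl

/-- A related pair is joined by walks of lengths n and n + n, so n = 0. -/
theorem Homogeneous.eq_of_idem {R : G.Homogeneous} (h : R * R = R) {a b : V} (hab : R.1 a b) :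
    a = b := by
  obtain ⟨n, hn⟩ := R.2
  obtain ⟨c, hac, hcb⟩ := mul_iff.1 ((iff_of_eq h a b).2 hab)
  have h0 : n + n = n := G.length_unique (G.comp (hn _ _ hac) (hn _ _ hcb)) (hn _ _ hab)
  obtain rfl : n = 0 := by lia
  exact G.walk_zero.1 (hn _ _ hab)

/-- The length of `T` cancels from the two walks from `a` to `c`, so `b` and `b'` lie at the same
distance along them. -/
theorem Homogeneous.mid_eq {R S T : G.Homogeneous} {a b b' c : V} (h : R.1 a b) (h' : T.1 b c)
    (h₁ : S.1 a b') (h₂ : T.1 b' c) : b = b' := by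
  obtain ⟨p, hp⟩ := R.2
  obtain ⟨q, hq⟩ := S.2
  obtain ⟨r, hr⟩ := T.2
  have e : p + r = q + r := G.length_unique (G.comp (hp _ _ h) (hr _ _ h'))
    (G.comp (hq _ _ h₁) (hr _ _ h₂))
  obtain rfl : p = q := by lia
  exact G.point_unique (hp _ _ h) (hr _ _ h') (hq _ _ h₁) (hr _ _ h₂)

theorem Homogeneous.mid_eq' {R S T : G.Homogeneous} {a b b' c : V} (h : T.1 a b) (h' : R.1 b c)
    (h₁ : T.1 a b') (h₂ : S.1 b' c) : b = b' := by
  obtain ⟨p, hp⟩ := R.2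
  obtain ⟨q, hq⟩ := S.2
  obtain ⟨r, hr⟩ := T.2
  have e : r + p = r + q := G.length_unique (G.comp (hr _ _ h) (hp _ _ h'))
    (G.comp (hr _ _ h₁) (hq _ _ h₂))
  obtain rfl : p = q := by lia
  exact G.point_unique (hr _ _ h) (hp _ _ h') (hr _ _ h₁) (hq _ _ h₂)

/-- The identities hold for all binary relations; only the two quasi-identities need homogeneity,
through `Homogeneous.eq_of_idem` and `Homogeneous.mid_eq`. -/
theorem isLeftAdequate : IsLeftAdequate G.Homogeneous where
  plus_mul_self R := Homogeneous.ext fun a b => by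
    simp only [mul_iff, plus_iff]
    exact ⟨by rintro ⟨_, ⟨rfl, _⟩, h⟩; exact h, fun h => ⟨a, ⟨rfl, b, h⟩, h⟩⟩
  plus_plus_mul_plus R S := Homogeneous.ext fun a b => by
    simp only [mul_iff, plus_iff]; grind
  plus_mul_comm R S := Homogeneous.ext fun a b => by
    simp only [mul_iff, plus_iff]; grind
  plus_mul R S := Homogeneous.ext fun a b => by
    simp only [mul_iff, plus_iff]; grind
  eq_plus_of_idem R h := Homogeneous.ext fun a b => by
    rw [plus_iff]
    constructor
    · exact fun hab => ⟨Homogeneous.eq_of_idem h hab, b, hab⟩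
    · rintro ⟨rfl, c, hac⟩
      obtain rfl := Homogeneous.eq_of_idem h hac
      exact hac
  mul_plus_cancel R S T h := by
    have key : ∀ {R S : G.Homogeneous}, R * T = S * T → ∀ a b,
        (R * plus T).1 a b → (S * plus T).1 a b := by
      rintro R S h a b ⟨_, hR, rfl, c, hT⟩
      obtain ⟨b', hS, hT'⟩ := mul_iff.1 ((Homogeneous.iff_of_eq h a c).1 ⟨_, hR, hT⟩)
      obtain rfl := Homogeneous.mid_eq hR hT hS hT'
      exact ⟨_, hS, rfl, c, hT⟩
    exact Homogeneous.ext fun a b => ⟨key h a b, key h.symm a b⟩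

theorem isRightAdequate : IsRightAdequate G.Homogeneous where
  mul_ast_self R := Homogeneous.ext fun a b => by
    simp only [mul_iff, ast_iff]
    exact ⟨by rintro ⟨_, h, rfl, _⟩; exact h, fun h => ⟨b, h, rfl, a, h⟩⟩
  ast_ast_mul_ast R S := Homogeneous.ext fun a b => by
    simp only [mul_iff, ast_iff]; grind
  ast_mul_comm R S := Homogeneous.ext fun a b => by
    simp only [mul_iff, ast_iff]; grind
  ast_mul R S := Homogeneous.ext fun a b => by
    simp only [mul_iff, ast_iff]; grind
  eq_ast_of_idem R h := Homogeneous.ext fun a b => by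
    rw [ast_iff]
    constructor
    · intro hab
      obtain rfl := Homogeneous.eq_of_idem h hab
      exact ⟨rfl, a, hab⟩
    · rintro ⟨rfl, c, hca⟩
      obtain rfl := Homogeneous.eq_of_idem h hca
      exact hca
  ast_mul_cancel R S T h := by
    have key : ∀ {R S : G.Homogeneous}, T * R = T * S → ∀ a b,
        (ast T * R).1 a b → (ast T * S).1 a b := by
      rintro R S h a b ⟨_, ⟨rfl, c, hT⟩, hR⟩
      obtain ⟨b', hT', hS⟩ := mul_iff.1 ((Homogeneous.iff_of_eq h c b).1 ⟨_, hT, hR⟩)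
      obtain rfl := Homogeneous.mid_eq' hT hR hT' hS
      exact ⟨_, ⟨rfl, c, hT⟩, hS⟩
    exact Homogeneous.ext fun a b => ⟨key h a b, key h.symm a b⟩

theorem isAdequate : IsAdequate G.Homogeneous := ⟨isLeftAdequate, isRightAdequate⟩

end UniqueWalks

/-! ### Oriented paths -/

/-- The graph on `ℕ` with an edge `i → i + 1` if `d i = some true`, an edge `i + 1 → i` if
`d i = some false`, and no edge between `i` and `i + 1` otherwise. -/
def pathGraph (d : ℕ → Option Bool) : UniqueWalks ℕ where
  walk n a b := (b = a + n ∧ ∀ i, a ≤ i → i < a + n → d i = some true) ∨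
    (a = b + n ∧ ∀ i, b ≤ i → i < b + n → d i = some false)
  walk_zero := by
    intro a b
    constructor
    · rintro (⟨h, -⟩ | ⟨h, -⟩) <;> lia
    · rintro rfl
      exact .inl ⟨rfl, by lia⟩
  comp := by
    rintro p q a b c (⟨rfl, h⟩ | ⟨rfl, h⟩) (⟨h₁, h'⟩ | ⟨h₁, h'⟩)
    · subst h₁
      refine .inl ⟨by lia, fun i hi hi' => ?_⟩
      by_cases hb : i < a + p
      · exact h i hi hb
      · exact h' i (by lia) (by lia)
    -- The walks run in opposite directions; were both nonempty, the edge at the turn would have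
    -- both orientations.
    · rcases Nat.eq_zero_or_pos p with rfl | hp
      · exact .inr ⟨by lia, fun i hi hi' => h' i hi (by lia)⟩
      · rcases Nat.eq_zero_or_pos q with rfl | hq
        · exact .inl ⟨by lia, fun i hi hi' => h i hi (by lia)⟩
        · have e := h (a + p - 1) (by lia) (by lia)
          rw [h' (a + p - 1) (by lia) (by lia)] at e
          cases e
    · subst h₁
      rcases Nat.eq_zero_or_pos p with rfl | hp
      · exact .inl ⟨by lia, fun i hi hi' => h' i hi (by lia)⟩
      · rcases Nat.eq_zero_or_pos q with rfl | hq
        · exact .inr ⟨by lia, fun i hi hi' => h i (by lia) (by lia)⟩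
        · have e := h b (by lia) (by lia)
          rw [h' b (by lia) (by lia)] at e
          cases e
    · subst h₁
      refine .inr ⟨by lia, fun i hi hi' => ?_⟩
      by_cases hb : i < c + q
      · exact h' i hi hb
      · exact h i (by lia) (by lia)
  length_unique := by
    rintro p q a b (⟨h, -⟩ | ⟨h, -⟩) (⟨h', -⟩ | ⟨h', -⟩) <;> lia
  point_unique := by
    rintro p q a b b' c (⟨h₁, k₁⟩ | ⟨h₁, k₁⟩) (⟨h₂, k₂⟩ | ⟨h₂, k₂⟩) (⟨h₃, -⟩ | ⟨h₃, -⟩)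
      (⟨h₄, -⟩ | ⟨h₄, -⟩) <;> try lia
    -- What arithmetic leaves open is `a = c` with `b` and `b'` at distance `p` on opposite sides;
    -- the edge at the turn `b` then has both orientations unless `p = 0`.
    · rcases Nat.eq_zero_or_pos p with rfl | hp
      · lia
      · have e := k₁ (b - 1) (by lia) (by lia)
        rw [k₂ (b - 1) (by lia) (by lia)] at e
        cases e
    · rcases Nat.eq_zero_or_pos p with rfl | hp
      · lia
      · have e := k₁ b (by lia) (by lia)
        rw [k₂ b (by lia) (by lia)] at e
        cases e

/-- The edge relation of `pathGraph d`. -/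
def edge (d : ℕ → Option Bool) : (pathGraph d).Homogeneous := ⟨(pathGraph d).walk 1, 1, by simp⟩

theorem edge_iff {d : ℕ → Option Bool} {a b : ℕ} :
    (edge d).1 a b ↔ (b = a + 1 ∧ d a = some true) ∨ (a = b + 1 ∧ d b = some false) := by
  have h : ∀ (x : ℕ) (t : Option Bool), (∀ i, x ≤ i → i < x + 1 → d i = t) ↔ d x = t :=
    fun x t => ⟨fun h => h x le_rfl (by lia), fun h i hi hi' => by
      obtain rfl : i = x := by lia
      exact h⟩
  exact or_congr (and_congr_right fun _ => h a _) (and_congr_right fun _ => h b _)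

/-- The relation on `ℕ` that a word defines in `pathGraph d`. -/
def Holds {X : Type u} (d : ℕ → Option Bool) (w : Word X) (a b : ℕ) : Prop :=
  (w.eval fun _ => edge d).1 a b

theorem Holds.congr {X : Type u} {s t : Word X} (h : FAd.mk s = FAd.mk t)
    {d : ℕ → Option Bool} {a b : ℕ} (hs : Holds d s a b) : Holds d t a b := by
  have e := FAd.eval_eq_of_rel (UniqueWalks.isAdequate (G := pathGraph d)) (fun _ => edge d)
    (FAd.exact h)
  exact (UniqueWalks.Homogeneous.iff_of_eq e a b).1 hs

/-- A word that holds somewhere needs no more edges for that than it has letters. -/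
theorem Holds.exists_finset {X : Type u} {d : ℕ → Option Bool} {w : Word X} {a b : ℕ}
    (h : Holds d w a b) : ∃ F : Finset ℕ, F.card ≤ w.length ∧
      ∀ d' : ℕ → Option Bool, (∀ i ∈ F, d' i = d i) → Holds d' w a b := by
  induction w generalizing a b with
  | letter x =>
    rcases edge_iff.1 h with ⟨h₁, h₂⟩ | ⟨h₁, h₂⟩
    · exact ⟨{a}, le_rfl, fun d' hd => edge_iff.2 (.inl ⟨h₁, by simpa [h₂] using hd⟩)⟩
    · exact ⟨{b}, le_rfl, fun d' hd => edge_iff.2 (.inr ⟨h₁, by simpa [h₂] using hd⟩)⟩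
  | one => exact ⟨∅, le_rfl, fun d' _ => h⟩
  | mul s t ihs iht =>
    obtain ⟨c, h₁, h₂⟩ := h
    obtain ⟨F, hF, hs⟩ := ihs h₁
    obtain ⟨F', hF', ht⟩ := iht h₂
    refine ⟨F ∪ F', (Finset.card_union_le _ _).trans (Nat.add_le_add hF hF'), fun d' hd => ?_⟩
    exact ⟨c, hs d' fun i hi => hd i (Finset.mem_union_left _ hi),
      ht d' fun i hi => hd i (Finset.mem_union_right _ hi)⟩
  | plus s ih =>
    obtain ⟨rfl, c, h⟩ := h
    obtain ⟨F, hF, hs⟩ := ih h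
    exact ⟨F, hF, fun d' hd => ⟨rfl, c, hs d' hd⟩⟩
  | ast s ih =>
    obtain ⟨rfl, c, h⟩ := h
    obtain ⟨F, hF, hs⟩ := ih h
    exact ⟨F, hF, fun d' hd => ⟨rfl, c, hs d' hd⟩⟩

/-! ### Words that follow an oriented path -/

/-- The word for the tree that is a path, oriented according to `l`. -/
def pathWord {X : Type u} (x : X) : List Bool → Word X
  | [] => .one
  | true :: l => .plus (.mul (.letter x) (pathWord x l))
  | false :: l => .ast (.mul (pathWord x l) (.letter x))

theorem length_pathWord {X : Type u} (x : X) (l : List Bool) :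
    (pathWord x l).length = l.length := by
  induction l with
  | nil => rfl
  | cons c l ih => cases c <;> simp [pathWord, Word.length, ih, Nat.add_comm]

/-- `Follows d l a b`: one can walk in `pathGraph d` from `a` to `b`, traversing edges forwards or
backwards according to `l`. -/
inductive Follows (d : ℕ → Option Bool) : List Bool → ℕ → ℕ → Prop
  | nil (a : ℕ) : Follows d [] a a
  | forward {a b c : ℕ} {l : List Bool} : (edge d).1 a b → Follows d l b c →
      Follows d (true :: l) a c
  | backward {a b c : ℕ} {l : List Bool} : (edge d).1 b a → Follows d l b c →
      Follows d (false :: l) a c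

theorem Holds.eq_of_pathWord {X : Type u} {x : X} {d : ℕ → Option Bool} {l : List Bool} {a b : ℕ}
    (h : Holds d (pathWord x l) a b) : a = b := by
  rcases l with _ | ⟨_ | _, l⟩
  · exact h
  · exact h.1
  · exact h.1

theorem Follows.holds {X : Type u} (x : X) {d : ℕ → Option Bool} {l : List Bool} {a b : ℕ}
    (h : Follows d l a b) : Holds d (pathWord x l) a a := by
  induction h with
  | nil a => exact UniqueWalks.one_iff.2 rfl
  | forward h _ ih => exact ⟨rfl, _, _, h, ih⟩
  | backward h _ ih => exact ⟨rfl, _, _, ih, h⟩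

/-- Converse of `Follows.holds`. The endpoint is not determined, since the path may fold back on
itself. -/
theorem Holds.exists_follows {X : Type u} {x : X} {d : ℕ → Option Bool} {l : List Bool} {a : ℕ}
    (h : Holds d (pathWord x l) a a) : ∃ b, Follows d l a b := by
  induction l generalizing a with
  | nil => exact ⟨a, .nil a⟩
  | cons c l ih =>
    cases c with
    | true =>
      obtain ⟨-, e, b, h₁, h₂⟩ := h
      obtain rfl := Holds.eq_of_pathWord h₂
      obtain ⟨c, hc⟩ := ih h₂
      exact ⟨c, .forward h₁ hc⟩
    | false =>
      obtain ⟨-, e, b, h₁, h₂⟩ := h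
      obtain rfl := Holds.eq_of_pathWord h₁
      obtain ⟨c, hc⟩ := ih h₁
      exact ⟨c, .backward h₂ hc⟩

theorem follows_of_getElem? {d : ℕ → Option Bool} {l : List Bool} {a : ℕ}
    (h : ∀ i < l.length, d (a + i) = l[i]?) : Follows d l a (a + l.length) := by
  induction l generalizing a with
  | nil => exact .nil a
  | cons c l ih =>
    have h0 : d a = some c := by simpa using h 0 (by simp)
    have hl : Follows d l (a + 1) (a + (c :: l).length) := by
      have := ih (a := a + 1) fun i hi => by
        have := h (i + 1) (by simpa using hi)
        rw [List.getElem?_cons_succ] at this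
        rwa [Nat.add_assoc, Nat.add_comm 1 i]
      rwa [List.length_cons, Nat.add_comm l.length 1, ← Nat.add_assoc]
    cases c with
    | true => exact .forward (edge_iff.2 (.inl ⟨rfl, h0⟩)) hl
    | false => exact .backward (edge_iff.2 (.inr ⟨rfl, h0⟩)) hl

theorem Follows.le {d : ℕ → Option Bool} {l : List Bool} {a b : ℕ} (h : Follows d l a b) :
    b ≤ a + l.length := by
  induction h with
  | nil => simp
  | forward h _ ih =>
    rw [edge_iff] at h
    rw [List.length_cons]
    lia
  | backward h _ ih =>
    rw [edge_iff] at h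
    rw [List.length_cons]
    lia

/-- Each step moves by one, so reaching the maximal distance allowed by `Follows.le` leaves no room
for a step back. -/
theorem Follows.eq_getElem? {d : ℕ → Option Bool} {l : List Bool} {a b : ℕ} (h : Follows d l a b)
    (hb : b = a + l.length) : ∀ i < l.length, d (a + i) = l[i]? := by
  induction h with
  | nil => simp
  | forward h h' ih =>
    have hle := h'.le
    rw [List.length_cons] at hb
    obtain ⟨rfl, h0⟩ | ⟨rfl, -⟩ := edge_iff.1 h
    · rintro (_ | i) hi
      · simpa using h0
      · have := ih (by lia) i (by simpa using hi)
        rwa [List.getElem?_cons_succ, Nat.add_comm i 1, ← Nat.add_assoc]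
    · lia
  | backward h h' ih =>
    have hle := h'.le
    rw [List.length_cons] at hb
    obtain ⟨rfl, -⟩ | ⟨rfl, h0⟩ := edge_iff.1 h
    · lia
    · rintro (_ | i) hi
      · simpa using h0
      · have := ih (by lia) i (by simpa using hi)
        rwa [List.getElem?_cons_succ, Nat.add_comm i 1, ← Nat.add_assoc]

/-! ### Heights and peaks -/

/-- The height of the end of a path over its start. -/
def height : List Bool → ℤ
  | [] => 0
  | true :: l => height l + 1
  | false :: l => height l - 1

theorem height_append_singleton (l : List Bool) (c : Bool) :
    height (l ++ [c]) = height l + height [c] := by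
  induction l with
  | nil => simp [height]
  | cons e l ih => cases e <;> simp only [List.cons_append, height, ih] <;> ring

theorem height_take_succ {l : List Bool} {i : ℕ} {c : Bool} (h : l[i]? = some c) :
    height (l.take (i + 1)) = height (l.take i) + height [c] := by
  rw [List.take_add_one, h, Option.toList_some, height_append_singleton]

theorem height_of_edge {d : ℕ → Option Bool} {l : List Bool}
    (hd : ∀ i c, d i = some c → l[i]? = some c) {a b : ℕ} (h : (edge d).1 a b) :
    height (l.take b) = height (l.take a) + 1 := by
  obtain ⟨rfl, h0⟩ | ⟨rfl, h0⟩ := edge_iff.1 h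
  · rw [height_take_succ (hd _ _ h0)]
    simp [height]
  · rw [height_take_succ (hd _ _ h0)]
    simp [height]

theorem Follows.height_eq {d : ℕ → Option Bool} {l m : List Bool}
    (hd : ∀ i c, d i = some c → m[i]? = some c) {a b : ℕ} (h : Follows d l a b) :
    height (m.take b) = height (m.take a) + height l := by
  induction h with
  | nil => simp [height]
  | forward h _ ih => rw [ih, height_of_edge hd h, height]; ring
  | backward h _ ih => rw [ih, height_of_edge hd h, height]; ring

/-- A path that ends strictly above all its other points covers every path with the same end
height and length into which it maps. -/
theorem Follows.eq_getElem?_of_peak {d : ℕ → Option Bool} {l m : List Bool}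
    (hd : ∀ i c, d i = some c → m[i]? = some c) (hlen : l.length = m.length)
    (hm : ∀ i < m.length, height (m.take i) < height l) {b : ℕ} (h : Follows d l 0 b) :
    ∀ i < l.length, d i = l[i]? := by
  -- Stopping short of the end of `m` would put `b` below the height of `l`, whereas the path
  -- arrives at exactly that height.
  have hb : b = 0 + l.length := by
    have h₁ := h.le
    have h₂ := h.height_eq hd
    by_contra hne
    have h₃ := hm b (by lia)
    rw [h₂, List.take_zero, height] at h₃
    lia
  simpa using h.eq_getElem? hb

/-- Up-down and down-up zigzags according to the list, followed by `k` steps up. -/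
def zigzag (k : ℕ) : List Bool → List Bool
  | [] => List.replicate k true
  | c :: l => c :: (!c) :: zigzag k l

theorem length_zigzag (k : ℕ) (l : List Bool) : (zigzag k l).length = 2 * l.length + k := by
  induction l with
  | nil => simp [zigzag]
  | cons c l ih => simp only [zigzag, List.length_cons, ih]; ring

theorem zigzag_injective (k : ℕ) {l m : List Bool} (hlen : l.length = m.length)
    (h : zigzag k l = zigzag k m) : l = m := by
  induction l generalizing m with
  | nil => exact (List.length_eq_zero_iff.1 hlen.symm).symm
  | cons c l ih =>
    rcases m with _ | ⟨e, m⟩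
    · simp at hlen
    · simp only [zigzag, List.cons.injEq] at h
      rw [h.1, ih (by simpa using hlen) h.2.2]

theorem height_replicate (k : ℕ) : height (List.replicate k true) = k := by
  induction k with
  | zero => rfl
  | succ k ih => rw [List.replicate_succ, height, ih]; push_cast; rfl

theorem height_zigzag (k : ℕ) (l : List Bool) : height (zigzag k l) = k := by
  induction l with
  | nil => exact height_replicate k
  | cons c l ih => cases c <;> simp [zigzag, height, ih]

/-- The zigzags stay between heights -1 and 1 and return to 0, so for `k ≥ 2` only the end of the
climb reaches `k`. -/
theorem height_take_zigzag_lt {k : ℕ} (hk : 2 ≤ k) (l : List Bool) {i : ℕ}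
    (hi : i < (zigzag k l).length) : height ((zigzag k l).take i) < k := by
  induction l generalizing i with
  | nil =>
    rw [zigzag, List.length_replicate] at hi
    rw [zigzag, List.take_replicate, height_replicate]
    lia
  | cons c l ih =>
    rcases i with _ | _ | i
    · simp only [List.take_zero, height]; lia
    · cases c <;> simp only [zigzag, List.take_succ_cons, List.take_zero, height] <;> lia
    · have := ih (i := i) (by simpa [zigzag] using hi)
      cases c <;> simpa [zigzag, height] using this

theorem FAd.eval_of {X : Type u} (w : Word X) : w.eval FAd.of = FAd.mk w := by
  induction w with
  | letter x => rfl
  | one => rfl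
  | mul s t ihs iht => rw [Word.eval, ihs, iht]; rfl
  | plus s ih => rw [Word.eval, ih]; rfl
  | ast s ih => rw [Word.eval, ih]; rfl

/-! ### Path words with a peak in the free adequate monoid -/

section Peak

variable {X : Type u} (x : X) {l m : List Bool}

theorem mk_pathWord_injective (hlen : l.length = m.length)
    (hm : ∀ i < m.length, height (m.take i) < height l)
    (h : FAd.mk (pathWord x l) = FAd.mk (pathWord x m)) : l = m := by
  have hF : Follows (fun i => m[i]?) m 0 (0 + m.length) := follows_of_getElem? (by simp)
  obtain ⟨b, hb⟩ := ((hF.holds x).congr h.symm).exists_follows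
  have key := hb.eq_getElem?_of_peak (fun i c h => h) hlen hm
  exact List.ext_getElem? fun i => by
    by_cases hi : i < l.length
    · exact (key i hi).symm
    · rw [List.getElem?_eq_none (by lia), List.getElem?_eq_none (by lia)]

theorem mk_pathWord_mem_sphere (hl : ∀ i < l.length, height (l.take i) < height l) :
    FAd.mk (pathWord x l) ∈ FAd.sphere X l.length := by
  refine ⟨⟨_, (length_pathWord x l).le, FAd.eval_of _⟩, ?_⟩
  rintro n hn ⟨w, hw, h⟩
  rw [FAd.eval_of] at h
  have hF : Follows (fun i => l[i]?) l 0 (0 + l.length) := follows_of_getElem? (by simp)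
  obtain ⟨F, hcard, hF'⟩ := ((hF.holds x).congr h.symm).exists_finset
  -- Delete all edges outside `F`: `w` still holds at 0, hence so does the path word, and its path
  -- must cover every edge of `l`.
  obtain ⟨b, hb⟩ := ((hF' (fun i => if i ∈ F then l[i]? else none)
    fun i hi => if_pos hi).congr h).exists_follows
  have key := hb.eq_getElem?_of_peak (fun i c h => by split at h <;> simp_all) rfl hl
  have hsub : Finset.range l.length ⊆ F := fun i hi => by
    have hi := Finset.mem_range.1 hi
    by_contra hiF
    have := key i hi
    rw [if_neg hiF, List.getElem?_eq_getElem hi] at this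
    cases this
  have := Finset.card_le_card hsub
  rw [Finset.card_range] at this
  lia

end Peak

theorem FAd.two_pow_le_encard_sphere (X : Type u) [Nonempty X] (m : ℕ) {k : ℕ} (hk : 2 ≤ k) :
    ((2 ^ m : ℕ) : ℕ∞) ≤ (FAd.sphere X (2 * m + k)).encard := by
  obtain ⟨x⟩ := ‹Nonempty X›
  let φ : List.Vector Bool m → FAd X := fun c => FAd.mk (pathWord x (zigzag k c.1))
  have hφ : Function.Injective φ := fun c e h => by
    refine Subtype.ext (zigzag_injective k (c.2.trans e.2.symm) (mk_pathWord_injective x ?_ ?_ h))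
    · rw [length_zigzag, length_zigzag, c.2, e.2]
    · intro i hi
      rw [height_zigzag]
      exact height_take_zigzag_lt hk _ hi
  have hmem : Set.range φ ⊆ FAd.sphere X (2 * m + k) := by
    rintro _ ⟨c, rfl⟩
    have h := mk_pathWord_mem_sphere x (l := zigzag k c.1) fun i hi => by
      rw [height_zigzag]
      exact height_take_zigzag_lt hk _ hi
    rwa [length_zigzag, c.2] at h
  refine le_trans (le_of_eq ?_) (Set.encard_le_encard hmem)
  rw [← Set.image_univ, hφ.encard_image, Set.encard_univ, ENat.card_eq_coe_fintype_card,
    card_vector, Fintype.card_bool]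

theorem FAd.sphere_growsAtLeastExponentially (X : Type u) [Nonempty X] :
    GrowsAtLeastExponentially (fun n => (FAd.sphere X n).encard) := by
  have h1 : (1 : ℝ≥0) < 11 / 10 := by rw [← NNReal.coe_lt_coe]; norm_num
  have h2 : (11 / 10 : ℝ≥0) ^ 4 ≤ 2 := by rw [← NNReal.coe_le_coe]; norm_num
  -- Any c > 1 with c^4 ≤ 2 works. Taking `k` to be 2 or 3 by parity gives 4m ≥ 2n - 6, which is at
  -- least n from 6 on.
  refine ⟨11 / 10, h1, eventually_atTop.2 ⟨6, fun n hn => ?_⟩⟩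
  obtain ⟨m, k, hk, hmn, rfl⟩ : ∃ m k, 2 ≤ k ∧ n ≤ 4 * m ∧ n = 2 * m + k :=
    ⟨(n - 2) / 2, n - 2 * ((n - 2) / 2), by lia, by lia, by lia⟩
  have h3 : (11 / 10 : ℝ≥0) ^ (2 * m + k) ≤ 2 ^ m :=
    calc (11 / 10 : ℝ≥0) ^ (2 * m + k) ≤ (11 / 10) ^ (4 * m) := pow_le_pow_right₀ h1.le hmn
      _ = ((11 / 10) ^ 4) ^ m := pow_mul _ _ _
      _ ≤ 2 ^ m := pow_le_pow_left₀ zero_le h2 m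
  have h4 := ENat.toENNReal_le.2 (FAd.two_pow_le_encard_sphere X m hk)
  refine le_trans ?_ h4
  have h5 := ENNReal.coe_le_coe.2 h3
  push_cast at h5 ⊢
  exact h5

end AdequateGrowth

theorem mainTheorem6 (X : Type*) [Nonempty X] :
    (AdequateGrowth.GrowsAtLeastExponentially
        (fun n => (AdequateGrowth.FAd.sphere X n).encard) ∧
      AdequateGrowth.GrowsAtLeastExponentially
        (fun n => (AdequateGrowth.FAd.ball X n).encard)) ∧
    (Finite X →
      AdequateGrowth.GrowsAtMostExponentially
          (fun n => (AdequateGrowth.FAd.sphere X n).encard) ∧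
        AdequateGrowth.GrowsAtMostExponentially
          (fun n => (AdequateGrowth.FAd.ball X n).encard)) := by
  have hle : ∀ n, (AdequateGrowth.FAd.sphere X n).encard ≤ (AdequateGrowth.FAd.ball X n).encard :=
    fun n => Set.encard_le_encard (AdequateGrowth.FAd.sphere_subset_ball X n)
  have hlow := AdequateGrowth.FAd.sphere_growsAtLeastExponentially X
  refine ⟨⟨hlow, hlow.mono hle⟩, fun _ => ?_⟩
  have hup := AdequateGrowth.FAd.ball_growsAtMostExponentially X
  exact ⟨hup.mono hle, hup⟩
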